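/- Let $\mu$ be a $\sigma$-finite diffuse measure (no point has positive mass) on $(\mathbb{R},\mathcal{B}(\mathbb{R}))$ such that the real Hilbert space $\mathcal{H}=L^2(\mathbb{R},\mu)$ has a Hilbert basis $(e_n)_{n\in\mathbb{N}}$, which we fix. Let $(P_n)_{n\in\mathbb{N}}$ be probability measures on $\mathbb{R}$ with $\int x\,dP_n=0$, $\int x^2\,dP_n=1$, such that for every integer $p>0$ the function $x^p$ is integrable for all $P_n$ and $\int x^p\,dP_n\le K_p$ with $K_p$ independent of $n$. Let $P=\bigotimes_n P_n$ on $\mathbb{R}^{\mathbb{N}}$, and let $X_n$ be the canonical projections. For $f\in L^2(\mu\otimes\mu)$ set $$\varphi^{(2)}(f)=\sum_{j\ge 0}\langle f,e_j\otimes e_j\rangle (X_j^2-1),\qquad \varphi^{(1,1)}(f)=\sum_{j\ge 1}\Big(\sum_{k=0}^{j-1}\langle f,e_j\otimes e_k\rangle X_k\Big)X_j ,$$ the sums of the series being limits in $L^2(P)$ of their partial sums. Let $h_1,h_2\in\mathcal{H}$. For $t\ge 0$ put $C_t=\{(x,y):0\le x<y\le t\}$, $\bar C_t=\{(x,y):0\le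 y<x\le t\}$, and define the iterated integral $$Z_t=\int_0^t\Phi(h_1)_s\,d\Phi(h_2)_s:=\varphi^{(1,1)}\big((h_1\otimes h_2)1_{C_t}+(h_2\otimes h_1)1_{\bar C_t}\big)+\varphi^{(2)}\big((h_1\otimes h_2)1_{C_t}\big),$$ where $(h\otimes g)(x,y)=h(x)g(y)$. Then both series defining $Z_t$ converge in $L^2(P)$ for every $t\ge 0$, and the process $(Z_t)_{t\ge 0}$ has a continuous modification: there is a process $(Y_t)_{t\ge 0}$ on $(\mathbb{R}^{\mathbb{N}},P)$ all of whose paths $t\mapsto Y_t(\omega)$ are continuous and such that $Y_t=Z_t$ $P$-almost surely for each $t\ge 0$. -/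

import Mathlib

open MeasureTheory Filter Topology
open scoped NNReal ENNReal

namespace DoubleIntegral

noncomputable section

/-- The sample space `ℝ^ℕ`; the canonical projections are `X n ω = ω n`. -/
abbrev Omega : Type := ℕ → ℝ

/-- The `n`-th canonical projection of `ℝ^ℕ` on `ℝ`. -/
def X (n : ℕ) (ω : Omega) : ℝ := ω n

/-- Standing assumptions on the probability laws `ρ n`: centred, of variance one, all moments finite and bounded
above uniformly in `n`. -/
structure IsAdmissible (ρ : ℕ → Measure ℝ) : Prop where
  mean_eq_zero : ∀ n, ∫ x, x ∂(ρ n) = 0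
  second_moment_eq_one : ∀ n, ∫ x, x ^ 2 ∂(ρ n) = 1
  moments_bounded : ∀ p : ℕ, 0 < p → ∃ K : ℝ, ∀ n,
    Integrable (fun x : ℝ => x ^ p) (ρ n) ∧ ∫ x, x ^ p ∂(ρ n) ≤ K

/-- The product measure `P = ⨂ ρ n` on `ℝ^ℕ`. -/
def law (ρ : ℕ → Measure ℝ) [∀ n, IsProbabilityMeasure (ρ n)] : Measure Omega :=
  Measure.infinitePi ρ

/-- `Y` is the limit of the sequence `u` in `L²(P)`, all terms being in `L²(P)`. -/
def IsL2Limit (P : Measure Omega) (u : ℕ → Omega → ℝ) (Y : Omega → ℝ) : Prop :=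
  (∀ N, MemLp (u N) 2 P) ∧ MemLp Y 2 P ∧
    Tendsto (fun N => eLpNorm (u N - Y) 2 P) atTop (𝓝 0)

open Classical in
/-- A representative of the `L²(P)`-limit of the sequence `u` (zero if there is no limit). -/
def l2Limit (P : Measure Omega) (u : ℕ → Omega → ℝ) : Omega → ℝ :=
  if h : ∃ Y, IsL2Limit P u Y then h.choose else 0

section Series

variable {μ : Measure ℝ} (e : HilbertBasis ℕ ℝ (Lp ℝ 2 μ))

/-- The coefficient `⟨f, e_j ⊗ e_k⟩` in `L²(μ ⊗ μ)`. -/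
def coeff (f : ℝ × ℝ → ℝ) (j k : ℕ) : ℝ :=
  ∫ p, f p * (e j p.1 * e k p.2) ∂(μ.prod μ)

/-- Partial sums of the series of the `⟨f, e_j ⊗ e_j⟩ (X_j² - 1)`, `j ≥ 0`. -/
def phi2Partial (f : ℝ × ℝ → ℝ) (N : ℕ) (ω : Omega) : ℝ :=
  ∑ j ∈ Finset.range (N + 1), coeff e f j j * (X j ω ^ 2 - 1)

/-- Partial sums of the series of the `(∑_{k < j} ⟨f, e_j ⊗ e_k⟩ X_k) X_j`, `j ≥ 1`. -/
def phi11Partial (f : ℝ × ℝ → ℝ) (N : ℕ) (ω : Omega) : ℝ :=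
  ∑ j ∈ Finset.Icc 1 N, (∑ k ∈ Finset.range j, coeff e f j k * X k ω) * X j ω

/-- `φ^{(2)}(f)`. -/
def phi2 (P : Measure Omega) (f : ℝ × ℝ → ℝ) : Omega → ℝ :=
  l2Limit P (phi2Partial e f)

/-- `φ^{(1,1)}(f)`. -/
def phi11 (P : Measure Omega) (f : ℝ × ℝ → ℝ) : Omega → ℝ :=
  l2Limit P (phi11Partial e f)

/-- The triangle `C = {0 ≤ x < y ≤ t}`. -/
def lowerC (t : ℝ) : Set (ℝ × ℝ) := {p | 0 ≤ p.1 ∧ p.1 < p.2 ∧ p.2 ≤ t}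

/-- The reflected triangle `{0 ≤ y < x ≤ t}`. -/
def upperC (t : ℝ) : Set (ℝ × ℝ) := {p | 0 ≤ p.2 ∧ p.2 < p.1 ∧ p.1 ≤ t}

/-- The kernel `(h ⊗ g) 1_C`. -/
def kernel (h g : Lp ℝ 2 μ) (t : ℝ) : ℝ × ℝ → ℝ :=
  (lowerC t).indicator fun p => h p.1 * g p.2

/-- The symmetric kernel `(h ⊗ g) 1_C + (g ⊗ h) 1_{C'}`, `C'` the reflected triangle. -/
def symKernel (h g : Lp ℝ 2 μ) (t : ℝ) : ℝ × ℝ → ℝ :=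
  kernel h g t + (upperC t).indicator fun p => g p.1 * h p.2

/-- The double integral `Z_t = ∫_0^t Φ(h)_s dΦ(g)_s
  = φ^{(1,1)}((h ⊗ g) 1_C + (g ⊗ h) 1_{C'}) + φ^{(2)}((h ⊗ g) 1_C)`. -/
def Z (P : Measure Omega) (h g : Lp ℝ 2 μ) (t : ℝ≥0) : Omega → ℝ :=
  phi11 e P (symKernel h g t) + phi2 e P (kernel h g t)

end Series

/-- `Y` is a continuous modification of the process `V`. -/
def IsContinuousModification (P : Measure Omega) (V Y : ℝ≥0 → Omega → ℝ) : Prop :=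
  (∀ t, Measurable (Y t)) ∧ (∀ ω, Continuous fun t => Y t ω) ∧ ∀ t, Y t =ᵐ[P] V t

end

end DoubleIntegral

/-! The heart is the estimate E|Z_t - Z_s|⁴ ≤ C (F(t) - F(s))² with F(t) = ∫_0^t h₂² dμ, which
combines a moment bound for the two series with a computation on kernels.

Both series have terms A_j φ(X_j), where A_j depends only on the coordinates before j and φ(X_j) is
centred and independent of them. Fourth moments can therefore be followed one index at a time: in
E(S + AY)⁴ the term linear in Y vanishes, and a bound E f⁴ ≤ s² propagates additively in s
(`FourthMomentLE.add_mul`). Used once for φ^(2) and twice, nested, for φ^(1,1), this controls blocks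
of the series by sums of squared coefficients. Bessel's inequality for the e_j ⊗ e_k then gives
convergence in L², and Fatou's lemma gives a Lipschitz bound from L²(μ ⊗ μ) to L⁴(P)
(`IsAdmissible.exists_lintegral_phi_sub_le`). The kernels at times s < t differ only where the
larger coordinate lies in (s, t], so their squared distance is at most a multiple of ‖h₁‖² (F(t) -
F(s)).

The exponent 2 > 1 is what Kolmogorov's criterion needs, but for the clock F, which is continuous
because μ is diffuse and need not have any Hölder regularity. So time is changed by G(t) = t + F(t),
a continuous surjection of [0, ∞) whose increments dominate those of F. Kolmogorov's theorem applies
to Z read in the clock G, and composing the result with G gives the modification. -/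

namespace DoubleIntegral

/-! ### Kolmogorov's continuity theorem by dyadic chaining -/

/-- The largest dyadic number of order `m` that is at most `t`. -/
noncomputable def dyadicFloor (m : ℕ) (t : ℝ≥0) : ℝ≥0 := (⌊2 ^ m * t⌋₊ : ℝ≥0) / 2 ^ m

lemma dyadicFloor_le (m : ℕ) (t : ℝ≥0) : dyadicFloor m t ≤ t := by
  unfold dyadicFloor
  rw [div_le_iff₀ (by positivity), mul_comm]
  exact Nat.floor_le (by positivity)

lemma sub_dyadicFloor_le (m : ℕ) (t : ℝ≥0) :
    (t : ℝ) - dyadicFloor m t ≤ (1 / 2) ^ m := by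
  have h := (Nat.lt_floor_add_one (2 ^ m * t)).le
  have h' : (2 : ℝ) ^ m * t ≤ ⌊2 ^ m * t⌋₊ + 1 := by exact_mod_cast h
  unfold dyadicFloor
  push_cast
  rw [sub_le_iff_le_add, one_div, inv_pow, ← one_div, ← add_div, le_div_iff₀ (by positivity)]
  linarith

/-- The increments of `w` over the dyadic intervals of order `m` in `[0, T]` are at most `B r ^ m`. -/
def DyadicIncrementsLE (w : ℝ≥0 → ℝ) (r : ℝ) (T : ℕ) (B : ℝ) : Prop :=
  ∀ m k : ℕ, k < T * 2 ^ m → |w ((k + 1 : ℕ) / 2 ^ m) - w ((k : ℕ) / 2 ^ m)| ≤ B * r ^ m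

lemma floor_lt_of_lt {T : ℕ} {t : ℝ≥0} (ht : t < T) (m : ℕ) : ⌊2 ^ m * t⌋₊ < T * 2 ^ m := by
  rw [Nat.floor_lt (by positivity)]
  push_cast
  rw [mul_comm]
  gcongr

/-- Halving a dyadic interval either keeps the left endpoint or moves it to the midpoint, so at most
one increment of order m + 1 is involved. The strict bound t < T keeps that interval inside [0, T].
-/
lemma DyadicIncrementsLE.abs_dyadicFloor_succ_sub_le {w : ℝ≥0 → ℝ} {r : ℝ} {T : ℕ} {B : ℝ}
    (hw : DyadicIncrementsLE w r T B) (hr : 0 ≤ r) (hB : 0 ≤ B) {t : ℝ≥0} (ht : t < T) (m : ℕ) :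
    |w (dyadicFloor (m + 1) t) - w (dyadicFloor m t)| ≤ B * r ^ (m + 1) := by
  set k := ⌊2 ^ m * t⌋₊ with hk
  have hk1 : (k : ℝ≥0) ≤ 2 ^ m * t := Nat.floor_le (by positivity)
  have hk2 : 2 ^ m * t < (k : ℝ≥0) + 1 := Nat.lt_floor_add_one _
  have hl1 : 2 * k ≤ ⌊2 ^ (m + 1) * t⌋₊ := by
    apply Nat.le_floor
    push_cast
    rw [pow_succ, mul_comm _ (2 : ℝ≥0), mul_assoc]
    gcongr
  have hl2 : ⌊2 ^ (m + 1) * t⌋₊ < 2 * k + 2 := by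
    rw [Nat.floor_lt (by positivity)]
    push_cast
    calc (2 : ℝ≥0) ^ (m + 1) * t = 2 * (2 ^ m * t) := by ring
      _ < 2 * (k + 1) := by gcongr
      _ = _ := by ring
  have hd : dyadicFloor m t = ((2 * k : ℕ) : ℝ≥0) / 2 ^ (m + 1) := by
    unfold dyadicFloor
    rw [← hk]
    push_cast
    rw [pow_succ, mul_comm ((2 : ℝ≥0) ^ m) 2, mul_div_mul_left _ _ (by norm_num)]
  rcases (by omega : ⌊2 ^ (m + 1) * t⌋₊ = 2 * k ∨ ⌊2 ^ (m + 1) * t⌋₊ = 2 * k + 1) with h | h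
  · have : dyadicFloor (m + 1) t = dyadicFloor m t := by
      rw [hd, ← h]; rfl
    rw [this]
    simp only [sub_self, abs_zero]
    positivity
  · have : dyadicFloor (m + 1) t = ((2 * k + 1 : ℕ) : ℝ≥0) / 2 ^ (m + 1) := by
      rw [← h]; rfl
    rw [this, hd]
    refine hw _ _ ?_
    have := floor_lt_of_lt ht (m + 1)
    omega

/-- Points at distance at most 2^(-m) have dyadic floors that are equal or adjacent. -/
lemma DyadicIncrementsLE.abs_dyadicFloor_sub_le {w : ℝ≥0 → ℝ} {r : ℝ} {T : ℕ} {B : ℝ}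
    (hw : DyadicIncrementsLE w r T B) (hr : 0 ≤ r) (hB : 0 ≤ B) {s t : ℝ≥0} (hs : s < T)
    (ht : t < T) (m : ℕ) (hst : |(s : ℝ) - t| ≤ (1 / 2) ^ m) :
    |w (dyadicFloor m s) - w (dyadicFloor m t)| ≤ B * r ^ m := by
  wlog h : t ≤ s generalizing s t
  · rw [abs_sub_comm]
    rw [abs_sub_comm] at hst
    exact this ht hs hst (le_of_not_ge h)
  have h1 : ⌊2 ^ m * t⌋₊ ≤ ⌊2 ^ m * s⌋₊ := Nat.floor_mono (by gcongr)
  have h2 : ⌊2 ^ m * s⌋₊ ≤ ⌊2 ^ m * t⌋₊ + 1 := by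
    rw [← Nat.floor_add_one (by positivity)]
    apply Nat.floor_mono
    have h3 := (abs_le.1 hst).2
    rw [one_div, inv_pow, ← one_div, le_div_iff₀ (by positivity)] at h3
    have : (2 : ℝ) ^ m * s ≤ 2 ^ m * t + 1 := by linarith
    exact_mod_cast this
  rcases (by omega : ⌊2 ^ m * s⌋₊ = ⌊2 ^ m * t⌋₊ ∨ ⌊2 ^ m * s⌋₊ = ⌊2 ^ m * t⌋₊ + 1) with h | h
  · rw [dyadicFloor, dyadicFloor, h, sub_self, abs_zero]
    positivity
  · rw [dyadicFloor, dyadicFloor, h]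
    exact hw _ _ (floor_lt_of_lt ht m)

/-- A function with geometrically small dyadic increments agrees on the dyadic numbers, in the limit, with a
continuous function. -/
lemma exists_continuous_tendsto_dyadicFloor {w : ℝ≥0 → ℝ} {r : ℝ} (hr0 : 0 ≤ r) (hr1 : r < 1)
    (hw : ∀ T : ℕ, ∃ B, 0 ≤ B ∧ DyadicIncrementsLE w r T B) :
    ∃ y : ℝ≥0 → ℝ, Continuous y ∧
      ∀ t, Tendsto (fun m => w (dyadicFloor m t)) atTop (𝓝 (y t)) := by
  choose B hB0 hB using hw
  have hstep : ∀ {T : ℕ} {t : ℝ≥0}, t < T → ∀ m,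
      dist (w (dyadicFloor m t)) (w (dyadicFloor (m + 1) t)) ≤ B T * r * r ^ m := by
    intro T t ht m
    rw [dist_comm, Real.dist_eq, mul_assoc, ← pow_succ']
    exact (hB T).abs_dyadicFloor_succ_sub_le hr0 (hB0 T) ht m
  have hlim : ∀ t, ∃ y, Tendsto (fun m => w (dyadicFloor m t)) atTop (𝓝 y) := by
    intro t
    obtain ⟨T, hT⟩ := exists_nat_gt t
    exact cauchySeq_tendsto_of_complete (cauchySeq_of_le_geometric r _ hr1 (hstep hT))
  choose y hy using hlim
  refine ⟨y, ?_, hy⟩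
  rw [continuous_iff_continuousAt]
  intro t
  obtain ⟨T, hT⟩ := exists_nat_gt t
  rw [Metric.continuousAt_iff]
  intro ε hε
  have hdist : ∀ {s : ℝ≥0}, s < T → ∀ m,
      dist (w (dyadicFloor m s)) (y s) ≤ B T * r * r ^ m / (1 - r) := fun hs m =>
    dist_le_of_le_geometric_of_tendsto r _ hr1 (hstep hs) (hy _) m
  -- One increment between neighbouring dyadic floors, plus a geometric tail at each of s and t.
  have hsmall : Tendsto (fun m : ℕ => B T * r ^ m + 2 * (B T * r * r ^ m / (1 - r))) atTop (𝓝 0) := by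
    have h0 := tendsto_pow_atTop_nhds_zero_of_lt_one hr0 hr1
    have h1 := (h0.const_mul (B T)).add (((h0.const_mul (B T * r)).div_const (1 - r)).const_mul 2)
    simpa using h1
  obtain ⟨m, hm⟩ := (hsmall.eventually (gt_mem_nhds hε)).exists
  have hnhds : ∀ᶠ s : ℝ≥0 in 𝓝 t, s < (T : ℝ≥0) ∧ |(s : ℝ) - t| ≤ (1 / 2) ^ m := by
    refine (eventually_lt_nhds hT).and ?_
    filter_upwards [Metric.ball_mem_nhds t (ε := (1 / 2) ^ m) (by positivity)] with s hs
    rw [Metric.mem_ball, NNReal.dist_eq] at hs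
    exact hs.le
  obtain ⟨δ, hδ, hball⟩ := Metric.eventually_nhds_iff.1 hnhds
  refine ⟨δ, hδ, fun {s} hs => ?_⟩
  obtain ⟨hsT, hst⟩ := hball hs
  have h1 := hdist hsT m
  have h2 := hdist hT m
  have h3 := (hB T).abs_dyadicFloor_sub_le hr0 (hB0 T) hsT hT m hst
  rw [← Real.dist_eq] at h3
  have h4 := dist_triangle4 (y s) (w (dyadicFloor m s)) (w (dyadicFloor m t)) (y t)
  rw [dist_comm (y s) (w _)] at h4
  linarith

variable {Ω : Type*} [MeasurableSpace Ω] {P : Measure Ω}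

/-- Almost every path of a process satisfying the fourth moment condition has geometrically small dyadic
increments. -/
lemma ae_dyadicIncrementsLE {W : ℝ≥0 → Ω → ℝ} (hW : ∀ u, Measurable (W u)) {C : ℝ}
    (hC0 : 0 ≤ C)
    (hC : ∀ u v : ℝ≥0, ∫⁻ ω, ‖W u ω - W v ω‖ₑ ^ 4 ∂P ≤ ENNReal.ofReal (C * ((u : ℝ) - v) ^ 2)) :
    ∀ᵐ ω ∂P, ∀ T : ℕ, ∃ B, 0 ≤ B ∧ DyadicIncrementsLE (fun u => W u ω) (9 / 10) T B := by
  rw [ae_all_iff]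
  intro T
  set D : ℕ → ℕ → Ω → ℝ≥0∞ := fun m k ω =>
    ‖W ((k + 1 : ℕ) / 2 ^ m) ω - W ((k : ℕ) / 2 ^ m) ω‖ₑ ^ 4 with hD
  have hDm : ∀ m k, Measurable (D m k) := fun m k => ((hW _).sub (hW _)).enorm.pow_const 4
  -- The weight (10/9)^(4m) still leaves summable expectations: T 2^m intervals, each contributing C
  -- 4^(-m), give the ratio (10/9)⁴ · 2/4 = 5000/6561 < 1. Any rate r < 1 with r⁴ > 1/2 would serve
  -- in place of 9/10.
  set S : ℕ → Ω → ℝ≥0∞ := fun m ω =>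
    ∑ k ∈ Finset.range (T * 2 ^ m), ENNReal.ofReal ((10 / 9) ^ (4 * m)) * D m k ω with hS
  have hSm : ∀ m, Measurable (S m) := fun m =>
    Finset.measurable_fun_sum _ fun k _ => (hDm m k).const_mul _
  have hSint : ∀ m, ∫⁻ ω, S m ω ∂P ≤ ENNReal.ofReal (T * C * (5000 / 6561) ^ m) := by
    intro m
    rw [lintegral_finsetSum _ fun k _ => (hDm m k).const_mul _]
    have hk : ∀ k ∈ Finset.range (T * 2 ^ m),
        ∫⁻ ω, ENNReal.ofReal ((10 / 9) ^ (4 * m)) * D m k ω ∂P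
          ≤ ENNReal.ofReal ((10 / 9) ^ (4 * m) * (C * (1 / 4) ^ m)) := by
      intro k _
      rw [lintegral_const_mul _ (hDm m k), ENNReal.ofReal_mul (by positivity)]
      gcongr
      refine (hC _ _).trans (le_of_eq ?_)
      congr 2
      push_cast
      rw [← sub_div, add_sub_cancel_left, ← one_div_pow, ← pow_mul, mul_comm m 2, pow_mul]
      norm_num
    refine (Finset.sum_le_sum hk).trans (le_of_eq ?_)
    rw [Finset.sum_const, Finset.card_range, nsmul_eq_mul, ← ENNReal.ofReal_natCast,
      ← ENNReal.ofReal_mul (by positivity)]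
    congr 1
    push_cast
    rw [pow_mul, show (5000 / 6561 : ℝ) = 2 * ((10 / 9) ^ 4 * (1 / 4)) by norm_num, mul_pow, mul_pow]
    ring
  have hfin : ∫⁻ ω, ∑' m, S m ω ∂P ≠ ∞ := by
    rw [lintegral_tsum fun m => (hSm m).aemeasurable]
    refine ne_top_of_le_ne_top ?_ (ENNReal.tsum_le_tsum hSint)
    rw [← ENNReal.ofReal_tsum_of_nonneg (fun m => by positivity)]
    · exact ENNReal.ofReal_ne_top
    · exact (summable_geometric_of_lt_one (by norm_num) (by norm_num)).mul_left _
  filter_upwards [ae_lt_top (Measurable.tsum hSm) hfin] with ω hω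
  set M := (∑' m, S m ω).toReal with hM
  have hM0 : 0 ≤ M := ENNReal.toReal_nonneg
  -- The bound 1 + M avoids a fourth root, since M ≤ (1 + M)⁴.
  refine ⟨1 + M, by positivity, fun m k hk => ?_⟩
  set x := |W ((k + 1 : ℕ) / 2 ^ m) ω - W ((k : ℕ) / 2 ^ m) ω| with hx
  have hle : ENNReal.ofReal ((10 / 9) ^ (4 * m)) * D m k ω ≤ ∑' m, S m ω :=
    (Finset.single_le_sum (f := fun k => ENNReal.ofReal ((10 / 9) ^ (4 * m)) * D m k ω)
      (fun _ _ => zero_le) (Finset.mem_range.2 hk)).trans (ENNReal.le_tsum m)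
  have hreal : (10 / 9) ^ (4 * m) * x ^ 4 ≤ M := by
    have := ENNReal.toReal_mono hω.ne hle
    rw [ENNReal.toReal_mul, ENNReal.toReal_ofReal (by positivity), hD] at this
    simpa [ENNReal.toReal_pow, hx] using this
  have h4 : ((10 / 9) ^ m * x) ^ 4 ≤ (1 + M) ^ 4 := by
    rw [mul_pow, ← pow_mul, mul_comm m 4]
    refine hreal.trans ?_
    nlinarith [sq_nonneg M, mul_nonneg hM0 (sq_nonneg M), mul_nonneg (sq_nonneg M) (sq_nonneg M)]
  have h1 := (pow_le_pow_iff_left₀ (by positivity) (by positivity) (by norm_num)).1 h4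
  calc x = ((10 / 9) ^ m * x) * (9 / 10) ^ m := by
        rw [mul_right_comm, ← mul_pow]; norm_num
    _ ≤ (1 + M) * (9 / 10) ^ m := by gcongr

/-- The Kolmogorov continuity theorem for the fourth moment condition. -/
theorem exists_continuous_modification {W : ℝ≥0 → Ω → ℝ} (hW : ∀ u, Measurable (W u)) {C : ℝ}
    (hC0 : 0 ≤ C)
    (hC : ∀ u v : ℝ≥0, ∫⁻ ω, ‖W u ω - W v ω‖ₑ ^ 4 ∂P ≤ ENNReal.ofReal (C * ((u : ℝ) - v) ^ 2)) :
    ∃ Y : ℝ≥0 → Ω → ℝ, (∀ t, Measurable (Y t)) ∧ (∀ ω, Continuous fun t => Y t ω) ∧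
      ∀ t, Y t =ᵐ[P] W t := by
  -- Paths are set to zero on a measurable null set containing the bad ones, so that every path is
  -- continuous and each Y_t stays measurable.
  obtain ⟨A, hAsub, hAm, hA⟩ := exists_measurable_superset_of_null
    (ae_iff.1 (ae_dyadicIncrementsLE hW hC0 hC))
  have hpath : ∀ ω, ∃ y : ℝ≥0 → ℝ, Continuous y ∧
      ∀ t, Tendsto (fun m => Aᶜ.indicator (W (dyadicFloor m t)) ω) atTop (𝓝 (y t)) := by
    intro ω
    by_cases hω : ω ∈ A
    · exact ⟨0, continuous_const, fun t => by simp [hω]⟩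
    · have hgood : ∀ T : ℕ, ∃ B, 0 ≤ B ∧ DyadicIncrementsLE (fun u => W u ω) (9 / 10) T B := by
        by_contra h
        exact hω (hAsub h)
      simpa [hω] using exists_continuous_tendsto_dyadicFloor (by norm_num) (by norm_num) hgood
  choose y hyc hyt using hpath
  refine ⟨fun t ω => y ω t, fun t => ?_, hyc, fun t => ?_⟩
  · exact measurable_of_tendsto_metrizable
      (fun m => (hW (dyadicFloor m t)).indicator hAm.compl) (tendsto_pi_nhds.2 fun ω => hyt ω t)
  · have hAae : ∀ᵐ ω ∂P, ω ∉ A := measure_eq_zero_iff_ae_notMem.1 hA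
    -- By Fatou and the moment condition the liminf of |W(d_m t) - W(t)|⁴ vanishes almost surely;
    -- since W(d_m t) converges to y(t), this identifies y(t) with W(t).
    have hle : ∫⁻ ω, liminf (fun m => ‖W (dyadicFloor m t) ω - W t ω‖ₑ ^ 4) atTop ∂P ≤ 0 := by
      refine (lintegral_liminf_le fun m => ((hW _).sub (hW _)).enorm.pow_const 4).trans ?_
      refine (liminf_le_liminf (Eventually.of_forall fun m => hC (dyadicFloor m t) t)).trans ?_
      refine (Tendsto.liminf_eq ?_).le
      rw [← ENNReal.ofReal_zero]
      refine ENNReal.tendsto_ofReal ?_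
      have h0 : Tendsto (fun m : ℕ => ((1 / 2 : ℝ)) ^ m) atTop (𝓝 0) :=
        tendsto_pow_atTop_nhds_zero_of_lt_one (by norm_num) (by norm_num)
      have h1 : Tendsto (fun m : ℕ => C * ((1 / 2 : ℝ) ^ m) ^ 2) atTop (𝓝 0) := by
        simpa using (h0.pow 2).const_mul C
      refine squeeze_zero (fun m => by positivity) (fun m => ?_) h1
      refine mul_le_mul_of_nonneg_left ?_ hC0
      have h2 := sub_dyadicFloor_le m t
      have h3 : (dyadicFloor m t : ℝ) ≤ t := by exact_mod_cast dyadicFloor_le m t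
      exact sq_le_sq' (by linarith) (by linarith [show (0 : ℝ) ≤ (1 / 2) ^ m by positivity])
    have hzero := (lintegral_eq_zero_iff (Measurable.liminf fun m =>
      ((hW (dyadicFloor m t)).sub (hW t)).enorm.pow_const 4)).1 (le_antisymm hle zero_le)
    filter_upwards [hAae, hzero] with ω hω h0
    have hlim : Tendsto (fun m => W (dyadicFloor m t) ω) atTop (𝓝 (y ω t)) := by
      simpa [hω] using hyt ω t
    have h5 : ‖y ω t - W t ω‖ₑ ^ 4 = 0 :=
      (ENNReal.Tendsto.pow (hlim.sub_const (W t ω)).enorm).liminf_eq.symm.trans h0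
    simpa [sub_eq_zero] using h5

end DoubleIntegral

namespace DoubleIntegral
open ProbabilityTheory

/-! ### Fourth moments under independent centred increments -/

section FourthMoment

variable {Ω : Type*} [MeasurableSpace Ω] {P : Measure Ω}

/-- The fourth moment of `f` is finite and at most `s ^ 2`. -/
def FourthMomentLE (P : Measure Ω) (f : Ω → ℝ) (s : ℝ) : Prop :=
  Integrable (fun ω => f ω ^ 4) P ∧ ∫ ω, f ω ^ 4 ∂P ≤ s ^ 2

lemma FourthMomentLE.mono {f : Ω → ℝ} {s t : ℝ} (h : FourthMomentLE P f s) (hs : 0 ≤ s)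
    (hst : s ≤ t) : FourthMomentLE P f t :=
  ⟨h.1, h.2.trans (by gcongr)⟩

lemma FourthMomentLE.integral_sq_mul_sq_le {S A : Ω → ℝ} {s a : ℝ} (hS : FourthMomentLE P S s)
    (hA : FourthMomentLE P A a) (hSm : AEStronglyMeasurable S P) (hAm : AEStronglyMeasurable A P)
    (hs : 0 ≤ s) (ha : 0 ≤ a) : ∫ ω, S ω ^ 2 * A ω ^ 2 ∂P ≤ s * a := by
  have key : ∀ {f : Ω → ℝ} {r : ℝ}, FourthMomentLE P f r → 0 ≤ r → AEStronglyMeasurable f P →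
      MemLp (fun ω => f ω ^ 2) (ENNReal.ofReal 2) P ∧
        (∫ ω, (f ω ^ 2) ^ (2 : ℝ) ∂P) ^ (1 / (2 : ℝ)) ≤ r := by
    intro f r hf hr hfm
    constructor
    · rw [show ENNReal.ofReal 2 = 2 by simp, memLp_two_iff_integrable_sq (by fun_prop)]
      refine hf.1.congr (Eventually.of_forall fun ω => ?_)
      simp only
      ring
    · rw [← Real.sqrt_eq_rpow]
      refine Real.sqrt_le_iff.2 ⟨hr, ?_⟩
      refine le_trans (le_of_eq ?_) hf.2
      congr 1 with ω
      rw [Real.rpow_two]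
      ring
  obtain ⟨h1, h2⟩ := key hS hs hSm
  obtain ⟨h3, h4⟩ := key hA ha hAm
  refine (integral_mul_le_Lp_mul_Lq_of_nonneg Real.HolderConjugate.two_two
    (Eventually.of_forall fun ω => sq_nonneg _) (Eventually.of_forall fun ω => sq_nonneg _)
    h1 h3).trans ?_
  gcongr

lemma FourthMomentLE.integral_sq_le [IsProbabilityMeasure P] {S : Ω → ℝ} {s : ℝ}
    (hS : FourthMomentLE P S s) (hSm : AEStronglyMeasurable S P) (hs : 0 ≤ s) :
    ∫ ω, S ω ^ 2 ∂P ≤ s := by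
  have h1 : FourthMomentLE P (fun _ => (1 : ℝ)) 1 := by
    constructor <;> simp
  simpa using hS.integral_sq_mul_sq_le h1 hSm aestronglyMeasurable_const hs zero_le_one

lemma integrable_of_abs_le_pow_four_add {S A g : Ω → ℝ} (hS : Integrable (fun ω => S ω ^ 4) P)
    (hA : Integrable (fun ω => A ω ^ 4) P) (hg : AEStronglyMeasurable g P)
    (h : ∀ ω, |g ω| ≤ S ω ^ 4 + A ω ^ 4) : Integrable g P :=
  (hS.add hA).mono' hg (Eventually.of_forall h)

lemma abs_pow_three_mul_le (x y : ℝ) : |x ^ 3 * y| ≤ x ^ 4 + y ^ 4 := by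
  rw [abs_le]
  constructor <;>
  nlinarith [sq_nonneg (x ^ 2 - y ^ 2), sq_nonneg (x ^ 2), sq_nonneg (y ^ 2), sq_nonneg (x * y),
    sq_nonneg (x ^ 2 + x * y), sq_nonneg (x ^ 2 - x * y)]

lemma abs_sq_mul_sq_le (x y : ℝ) : |x ^ 2 * y ^ 2| ≤ x ^ 4 + y ^ 4 := by
  rw [abs_of_nonneg (by positivity)]
  nlinarith [sq_nonneg (x ^ 2 - y ^ 2), sq_nonneg (x ^ 2), sq_nonneg (y ^ 2)]

lemma integral_mul_pow_of_indepFun {S A Y : Ω → ℝ}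
    (hSA : IndepFun (fun ω => (S ω, A ω)) Y P) (hY : Measurable Y) {p : ℝ × ℝ → ℝ} (hp : Measurable p) (n : ℕ)
    (hint : Integrable (fun ω => p (S ω, A ω)) P) (hYint : Integrable (fun ω => Y ω ^ n) P) :
    Integrable (fun ω => p (S ω, A ω) * Y ω ^ n) P ∧
      ∫ ω, p (S ω, A ω) * Y ω ^ n ∂P = (∫ ω, p (S ω, A ω) ∂P) * ∫ ω, Y ω ^ n ∂P := by
  have hi : IndepFun (fun ω => p (S ω, A ω)) (fun ω => Y ω ^ n) P :=
    hSA.comp (φ := p) (ψ := fun y : ℝ => y ^ n) hp (by fun_prop)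
  exact ⟨hi.integrable_mul hint hYint,
    hi.integral_fun_mul_eq_mul_integral hint.1 (hY.pow_const n).aestronglyMeasurable⟩

/-- Adding a centred independent increment `A Y` to `S`. -/
theorem FourthMomentLE.add_mul [IsProbabilityMeasure P] {S A Y : Ω → ℝ} {s a K : ℝ}
    (hS : FourthMomentLE P S s) (hA : FourthMomentLE P A a) (hs : 0 ≤ s) (ha : 0 ≤ a)
    (hSm : Measurable S) (hAm : Measurable A) (hYm : Measurable Y)
    (hSA : IndepFun (fun ω => (S ω, A ω)) Y P) (hY0 : ∫ ω, Y ω ∂P = 0)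
    (hY4 : Integrable (fun ω => Y ω ^ 4) P) (hK : ∫ ω, Y ω ^ 4 ∂P ≤ K) :
    FourthMomentLE P (fun ω => S ω + A ω * Y ω) (s + 4 * (1 + K) * a) := by
  -- All moments of order at most 4 are bounded at once through |y|^i ≤ 1 + y⁴.
  have hYi : ∀ i ∈ Finset.range 5, Integrable (fun ω => Y ω ^ i) P ∧ |∫ ω, Y ω ^ i ∂P| ≤ 1 + K := by
    intro i hi
    have hb : ∀ ω, |Y ω ^ i| ≤ 1 + Y ω ^ 4 := by
      intro ω
      have h4 : Y ω ^ 4 = |Y ω| ^ 4 := (Even.pow_abs (by decide) _).symm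
      rw [abs_pow, h4]
      have hy := abs_nonneg (Y ω)
      rcases le_total (|Y ω|) 1 with h | h
      · linarith [pow_le_one₀ (n := i) hy h, pow_nonneg hy 4]
      · linarith [pow_le_pow_right₀ h (Nat.le_of_lt_succ (Finset.mem_range.1 hi))]
    have hint : Integrable (fun ω => 1 + Y ω ^ 4) P := (integrable_const _).add hY4
    refine ⟨hint.mono' (hYm.pow_const i).aestronglyMeasurable (Eventually.of_forall hb), ?_⟩
    refine (norm_integral_le_of_norm_le (f := fun ω => Y ω ^ i) hint (Eventually.of_forall hb)).trans ?_
    rw [integral_add (integrable_const _) hY4]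
    simpa using hK
  have hK0 : 0 ≤ K := (integral_nonneg fun ω => by positivity).trans hK
  have i31 : Integrable (fun ω => S ω ^ 3 * A ω) P :=
    integrable_of_abs_le_pow_four_add hS.1 hA.1 (by fun_prop) fun ω => abs_pow_three_mul_le _ _
  have i22 : Integrable (fun ω => S ω ^ 2 * A ω ^ 2) P :=
    integrable_of_abs_le_pow_four_add hS.1 hA.1 (by fun_prop) fun ω => abs_sq_mul_sq_le _ _
  have i13 : Integrable (fun ω => A ω ^ 3 * S ω) P :=
    integrable_of_abs_le_pow_four_add hA.1 hS.1 (by fun_prop) fun ω => abs_pow_three_mul_le _ _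
  obtain ⟨j1, e1⟩ := integral_mul_pow_of_indepFun hSA hYm (p := fun q => q.1 ^ 3 * q.2)
    (by fun_prop) 1 i31 (hYi 1 (by simp)).1
  obtain ⟨j2, e2⟩ := integral_mul_pow_of_indepFun hSA hYm (p := fun q => q.1 ^ 2 * q.2 ^ 2)
    (by fun_prop) 2 i22 (hYi 2 (by simp)).1
  obtain ⟨j3, e3⟩ := integral_mul_pow_of_indepFun hSA hYm (p := fun q => q.2 ^ 3 * q.1)
    (by fun_prop) 3 i13 (hYi 3 (by simp)).1
  obtain ⟨j4, e4⟩ := integral_mul_pow_of_indepFun hSA hYm (p := fun q => q.2 ^ 4)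
    (by fun_prop) 4 hA.1 hY4
  simp only [pow_one] at j1 e1 j2 e2 j3 e3 j4 e4
  have hexp : (fun ω => (S ω + A ω * Y ω) ^ 4) = fun ω => S ω ^ 4 +
      (4 * (S ω ^ 3 * A ω * Y ω) + (6 * (S ω ^ 2 * A ω ^ 2 * Y ω ^ 2) +
        (4 * (A ω ^ 3 * S ω * Y ω ^ 3) + A ω ^ 4 * Y ω ^ 4))) := by
    ext ω; ring
  have k3 : Integrable (fun ω => 4 * (A ω ^ 3 * S ω * Y ω ^ 3) + A ω ^ 4 * Y ω ^ 4) P :=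
    (j3.const_mul 4).add j4
  have k2 : Integrable (fun ω => 6 * (S ω ^ 2 * A ω ^ 2 * Y ω ^ 2) +
      (4 * (A ω ^ 3 * S ω * Y ω ^ 3) + A ω ^ 4 * Y ω ^ 4)) P :=
    (j2.const_mul 6).add k3
  have k1 : Integrable (fun ω => 4 * (S ω ^ 3 * A ω * Y ω) + (6 * (S ω ^ 2 * A ω ^ 2 * Y ω ^ 2) +
      (4 * (A ω ^ 3 * S ω * Y ω ^ 3) + A ω ^ 4 * Y ω ^ 4))) P :=
    (j1.const_mul 4).add k2
  refine ⟨by rw [hexp]; exact hS.1.add k1, ?_⟩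
  rw [hexp, integral_add hS.1 k1, integral_add (j1.const_mul 4) k2,
    integral_add (j2.const_mul 6) k3, integral_add (j3.const_mul 4) j4, integral_const_mul,
    integral_const_mul, integral_const_mul, e1, e2, e3, e4, hY0]
  have hCS := hS.integral_sq_mul_sq_le hA hSm.aestronglyMeasurable hAm.aestronglyMeasurable hs ha
  -- From 2|A³S| ≤ S²A² + A⁴.
  have b13 : |∫ ω, A ω ^ 3 * S ω ∂P| ≤ (s * a + a ^ 2) / 2 := by
    have hint : Integrable (fun ω => (S ω ^ 2 * A ω ^ 2 + A ω ^ 4) / 2) P :=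
      (i22.add hA.1).div_const 2
    refine (norm_integral_le_of_norm_le (f := fun ω => A ω ^ 3 * S ω) hint
      (Eventually.of_forall fun ω => ?_)).trans ?_
    · rw [Real.norm_eq_abs, abs_le]
      constructor <;>
      nlinarith [sq_nonneg (S ω * A ω - A ω ^ 2), sq_nonneg (S ω * A ω + A ω ^ 2)]
    · rw [integral_div, integral_add i22 hA.1]
      linarith [hA.2]
  have n22 : 0 ≤ ∫ ω, S ω ^ 2 * A ω ^ 2 ∂P := integral_nonneg fun ω => by positivity
  have n4 : 0 ≤ ∫ ω, A ω ^ 4 ∂P := integral_nonneg fun ω => by positivity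
  have t2 : (∫ ω, S ω ^ 2 * A ω ^ 2 ∂P) * ∫ ω, Y ω ^ 2 ∂P ≤ s * a * (1 + K) :=
    mul_le_mul hCS ((le_abs_self _).trans (hYi 2 (by simp)).2)
      (integral_nonneg fun ω => by positivity) (by positivity)
  have t3 : (∫ ω, A ω ^ 3 * S ω ∂P) * ∫ ω, Y ω ^ 3 ∂P ≤ (s * a + a ^ 2) / 2 * (1 + K) := by
    refine (le_abs_self _).trans ?_
    rw [abs_mul]
    exact mul_le_mul b13 (hYi 3 (by simp)).2 (abs_nonneg _) (by positivity)
  have t4 : (∫ ω, A ω ^ 4 ∂P) * ∫ ω, Y ω ^ 4 ∂P ≤ a ^ 2 * (1 + K) :=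
    mul_le_mul hA.2 (by linarith) (integral_nonneg fun ω => by positivity) (by positivity)
  have hS2 := hS.2
  have hKa : (1 + K) * a ^ 2 ≤ (1 + K) ^ 2 * a ^ 2 := by
    gcongr
    nlinarith
  -- The bounds add up to s² + (6 + 2)(1 + K)sa + (2 + 1)(1 + K)a². The factor 4 in the claim makes
  -- the cross term of the square exactly 8(1 + K)sa, and 16(1 + K)²a² absorbs the rest.
  nlinarith [mul_nonneg hs ha, sq_nonneg a]

end FourthMoment

/-! ### Martingale sums along the coordinate filtration -/

section Filtration

/-- The σ-algebra generated by the coordinates of index less than `j`. -/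
@[reducible] def past (j : ℕ) : MeasurableSpace Omega :=
  ⨆ k ∈ Set.Iio j, MeasurableSpace.comap (X k) inferInstance

lemma past_mono {i j : ℕ} (h : i ≤ j) : past i ≤ past j :=
  biSup_mono fun _ hk => lt_of_lt_of_le hk h

lemma measurable_X (k : ℕ) : Measurable (X k) := measurable_pi_apply k

lemma past_le (j : ℕ) : past j ≤ (inferInstance : MeasurableSpace Omega) :=
  iSup₂_le fun k _ => (measurable_X k).comap_le

lemma measurable_X_past {k j : ℕ} (h : k < j) : Measurable[past j] (X k) := by
  rw [measurable_iff_comap_le]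
  exact le_biSup (fun k => MeasurableSpace.comap (X k) inferInstance) (show k ∈ Set.Iio j from h)

variable {ρ : ℕ → Measure ℝ} [∀ n, IsProbabilityMeasure (ρ n)]

instance : IsProbabilityMeasure (law ρ) := by
  unfold law; infer_instance

lemma measurePreserving_X (j : ℕ) : MeasurePreserving (X j) (law ρ) (ρ j) :=
  measurePreserving_eval_infinitePi ρ j

lemma indepFun_past {β : Type*} [MeasurableSpace β] {j : ℕ} {F : Omega → β}
    (hF : Measurable[past j] F) {φ : ℝ → ℝ} (hφ : Measurable φ) :
    IndepFun F (fun ω => φ (X j ω)) (law ρ) := by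
  have hi : iIndepFun X (law ρ) :=
    iIndepFun_infinitePi (P := ρ) (X := fun _ x => x) fun _ => measurable_id
  have h := indep_iSup_of_disjoint (fun k => (measurable_X k).comap_le) hi.iIndep
    (S := Set.Iio j) (T := {j}) (by simp)
  rw [IndepFun_iff_Indep]
  refine indep_of_indep_of_le_left (indep_of_indep_of_le_right h ?_)
    (measurable_iff_comap_le.1 hF)
  refine measurable_iff_comap_le.1 (hφ.comp ?_)
  rw [measurable_iff_comap_le]
  exact le_biSup (fun k => MeasurableSpace.comap (X k) inferInstance) (Set.mem_singleton j)

/-- The fourth moment of a sum of products `A j * φ (X j)`, the factor `A j` depending on the coordinates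
of index less than `j`. -/
theorem fourthMomentLE_sum_mul {A : ℕ → Omega → ℝ} {a : ℕ → ℝ} {φ : ℝ → ℝ} {K : ℝ}
    (hA : ∀ j, Measurable[past j] (A j)) (ha : ∀ j, 0 ≤ a j)
    (hA4 : ∀ j, FourthMomentLE (law ρ) (A j) (a j)) (hφ : Measurable φ)
    (hφ0 : ∀ j, ∫ x, φ x ∂(ρ j) = 0) (hφ4 : ∀ j, Integrable (fun x => φ x ^ 4) (ρ j))
    (hK : ∀ j, ∫ x, φ x ^ 4 ∂(ρ j) ≤ K) {m n : ℕ} (hmn : m ≤ n) :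
    Measurable[past n] (fun ω => ∑ j ∈ Finset.Ico m n, A j ω * φ (X j ω)) ∧
      FourthMomentLE (law ρ) (fun ω => ∑ j ∈ Finset.Ico m n, A j ω * φ (X j ω))
        (4 * (1 + K) * ∑ j ∈ Finset.Ico m n, a j) := by
  have hK0 : 0 ≤ K := (integral_nonneg fun ω => by positivity).trans (hK 0)
  induction n, hmn using Nat.le_induction with
  | base =>
    simp only [Finset.Ico_self, Finset.sum_empty]
    exact ⟨measurable_const, by constructor <;> simp⟩
  | succ n hmn ih =>
    obtain ⟨ihm, ih4⟩ := ih
    simp only [Finset.sum_Ico_succ_top hmn]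
    constructor
    · refine (ihm.mono (past_mono n.le_succ) le_rfl).add
        (((hA n).mono (past_mono n.le_succ) le_rfl).mul ?_)
      exact hφ.comp (measurable_X_past n.lt_succ_self)
    · rw [mul_add]
      have hmp := measurePreserving_X (ρ := ρ) n
      have hφY : ∀ {g : ℝ → ℝ}, Measurable g → ∫ ω, g (X n ω) ∂(law ρ) = ∫ x, g x ∂(ρ n) := by
        intro g hg
        rw [← hmp.map_eq, integral_map hmp.measurable.aemeasurable hg.aestronglyMeasurable]
      refine ih4.add_mul (hA4 n) (mul_nonneg (by positivity) (Finset.sum_nonneg fun j _ => ha j))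
        (ha n) (ihm.mono (past_le n) le_rfl) ((hA n).mono (past_le n) le_rfl)
        (hφ.comp (measurable_X n)) (indepFun_past (ihm.prodMk (hA n)) hφ) ?_ ?_ ?_
      · rw [hφY hφ, hφ0]
      · exact hmp.integrable_comp_of_integrable (hφ4 n)
      · rw [hφY (g := fun x => φ x ^ 4) (hφ.pow_const 4)]
        exact hK n

end Filtration

end DoubleIntegral

namespace DoubleIntegral
open ProbabilityTheory

/-! ### Convergence in L² and fourth moments of the limits -/

section L2Limits

lemma FourthMomentLE.memLp_two {Ω : Type*} [MeasurableSpace Ω] {P : Measure Ω}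
    [IsProbabilityMeasure P] {f : Ω → ℝ} {s : ℝ} (hf : FourthMomentLE P f s)
    (hfm : AEStronglyMeasurable f P) : MemLp f 2 P := by
  rw [memLp_two_iff_integrable_sq hfm]
  refine ((integrable_const 1).add hf.1).mono' (hfm.pow 2) (Eventually.of_forall fun ω => ?_)
  rw [Pi.add_apply, Real.norm_eq_abs, abs_of_nonneg (by positivity)]
  nlinarith [sq_nonneg (f ω ^ 2 - 1), sq_nonneg (f ω ^ 2)]

lemma FourthMomentLE.eLpNorm_two_le {Ω : Type*} [MeasurableSpace Ω] {P : Measure Ω}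
    [IsProbabilityMeasure P] {f : Ω → ℝ} {s : ℝ} (hf : FourthMomentLE P f s)
    (hfm : AEStronglyMeasurable f P) (hs : 0 ≤ s) :
    eLpNorm f 2 P ≤ ENNReal.ofReal (√s) := by
  rw [(hf.memLp_two hfm).eLpNorm_eq_integral_rpow_norm (by norm_num) (by norm_num)]
  refine ENNReal.ofReal_le_ofReal ?_
  have h := hf.integral_sq_le hfm hs
  simp only [ENNReal.toReal_ofNat, Real.rpow_two, Real.norm_eq_abs, sq_abs]
  rw [Real.sqrt_eq_rpow, one_div]
  exact Real.rpow_le_rpow (integral_nonneg fun ω => sq_nonneg _) h (by norm_num)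

lemma FourthMomentLE.lintegral_le {Ω : Type*} [MeasurableSpace Ω] {P : Measure Ω}
    {f : Ω → ℝ} {s : ℝ} (hf : FourthMomentLE P f s) :
    ∫⁻ ω, ‖f ω‖ₑ ^ 4 ∂P ≤ ENNReal.ofReal (s ^ 2) := by
  refine le_trans (le_of_eq ?_) (ENNReal.ofReal_le_ofReal hf.2)
  rw [ofReal_integral_eq_lintegral_ofReal hf.1 (Eventually.of_forall fun ω => by positivity)]
  congr 1 with ω
  rw [← Even.pow_abs (by decide) (f ω), ENNReal.ofReal_pow (abs_nonneg _), ← Real.enorm_eq_ofReal_abs]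

variable {P : Measure Omega}

lemma isL2Limit_l2Limit {u : ℕ → Omega → ℝ} (h : ∃ Y, IsL2Limit P u Y) :
    IsL2Limit P u (l2Limit P u) := by
  rw [l2Limit, dif_pos h]
  exact h.choose_spec

/-- A series whose blocks have fourth moments controlled by those of a summable series converges in
`L²`. -/
theorem exists_isL2Limit [IsProbabilityMeasure P] {D : ℕ → Omega → ℝ} {a : ℕ → ℝ}
    (hD : ∀ j, Measurable (D j)) (ha : ∀ j, 0 ≤ a j) (hsum : Summable a)
    (hblock : ∀ m n, m ≤ n → FourthMomentLE P (fun ω => ∑ j ∈ Finset.Ico m n, D j ω)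
      (∑ j ∈ Finset.Ico m n, a j)) :
    ∃ Y, IsL2Limit P (fun N ω => ∑ j ∈ Finset.range (N + 1), D j ω) Y := by
  set u : ℕ → Omega → ℝ := fun N ω => ∑ j ∈ Finset.range (N + 1), D j ω with hu
  have hum : ∀ m n, AEStronglyMeasurable (fun ω => ∑ j ∈ Finset.Ico m n, D j ω) P := fun m n =>
    (Finset.measurable_fun_sum _ fun j _ => hD j).aestronglyMeasurable
  have huL : ∀ N, MemLp (u N) 2 P := by
    intro N
    have := (hblock 0 (N + 1) (Nat.zero_le _)).memLp_two (hum _ _)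
    rwa [← Finset.range_eq_Ico] at this
  set v : ℕ → Lp ℝ 2 P := fun N => (huL N).toLp (u N) with hv
  have hcauchy : CauchySeq v := by
    rw [Metric.cauchySeq_iff']
    intro ε hε
    -- The tolerance is ε² because the L² norm of a block is at most the square root of its sum of
    -- a_j.
    obtain ⟨N, hN⟩ := Metric.cauchySeq_iff'.1 hsum.hasSum.tendsto_sum_nat.cauchySeq (ε ^ 2)
      (by positivity)
    refine ⟨N, fun n hn => ?_⟩
    have hs0 : 0 ≤ ∑ j ∈ Finset.Ico (N + 1) (n + 1), a j := Finset.sum_nonneg fun j _ => ha j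
    have hsub : u n - u N = fun ω => ∑ j ∈ Finset.Ico (N + 1) (n + 1), D j ω := by
      ext ω
      rw [Pi.sub_apply, hu, Finset.sum_Ico_eq_sub _ (by omega)]
    have hle : eLpNorm (u n - u N) 2 P ≤
        ENNReal.ofReal (√(∑ j ∈ Finset.Ico (N + 1) (n + 1), a j)) := by
      rw [hsub]
      exact (hblock _ _ (by omega)).eLpNorm_two_le (hum _ _) hs0
    rw [Lp.dist_edist, Lp.edist_toLp_toLp]
    refine lt_of_le_of_lt (ENNReal.toReal_le_of_le_ofReal (Real.sqrt_nonneg _) hle) ?_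
    rw [Real.sqrt_lt' hε]
    have h1 := hN (n + 1) (by omega)
    rw [Real.dist_eq, ← Finset.sum_Ico_eq_sub _ (by omega)] at h1
    refine lt_of_le_of_lt ?_ (lt_of_le_of_lt (le_abs_self _) h1)
    exact Finset.sum_le_sum_of_subset_of_nonneg
      (Finset.Ico_subset_Ico_left (by omega)) fun j _ _ => ha j
  obtain ⟨Y, hY⟩ := cauchySeq_tendsto_of_complete hcauchy
  refine ⟨Y, huL, Lp.memLp Y, ?_⟩
  rwa [← Lp.tendsto_Lp_iff_tendsto_eLpNorm'' u huL Y (Lp.memLp Y), Lp.toLp_coeFn]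

/-- Fatou's lemma for the fourth moment of the difference of two `L²`-limits. -/
lemma IsL2Limit.lintegral_sub_le {u v : ℕ → Omega → ℝ} {Y V : Omega → ℝ} (hu : IsL2Limit P u Y)
    (hv : IsL2Limit P v V) {s : ℝ} (h : ∀ N, FourthMomentLE P (u N - v N) s) :
    ∫⁻ ω, ‖Y ω - V ω‖ₑ ^ 4 ∂P ≤ ENNReal.ofReal (s ^ 2) := by
  have hlim : Tendsto (fun N => eLpNorm (u N - v N - (Y - V)) 2 P) atTop (𝓝 0) := by
    have h0 := hu.2.2.add hv.2.2
    rw [add_zero] at h0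
    refine tendsto_of_tendsto_of_tendsto_of_le_of_le tendsto_const_nhds h0
      (fun N => zero_le) fun N => ?_
    rw [sub_sub_sub_comm]
    exact eLpNorm_sub_le ((hu.1 N).sub hu.2.1).1 ((hv.1 N).sub hv.2.1).1 (by norm_num)
  -- Fatou needs pointwise convergence, so an almost surely convergent subsequence is extracted.
  obtain ⟨ns, -, hns⟩ := (tendstoInMeasure_of_tendsto_eLpNorm (by norm_num)
    (fun N => ((hu.1 N).sub (hv.1 N)).1) (hu.2.1.sub hv.2.1).1 hlim).exists_seq_tendsto_ae
  calc ∫⁻ ω, ‖Y ω - V ω‖ₑ ^ 4 ∂P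
      = ∫⁻ ω, liminf (fun i => ‖(u (ns i) - v (ns i)) ω‖ₑ ^ 4) atTop ∂P := by
        refine lintegral_congr_ae ?_
        filter_upwards [hns] with ω hω
        exact (ENNReal.Tendsto.pow hω.enorm).liminf_eq.symm
    _ ≤ liminf (fun i => ∫⁻ ω, ‖(u (ns i) - v (ns i)) ω‖ₑ ^ 4 ∂P) atTop :=
        lintegral_liminf_le' fun i => ((hu.1 _).sub (hv.1 _)).1.enorm.pow_const 4
    _ ≤ liminf (fun _ : ℕ => ENNReal.ofReal (s ^ 2)) atTop :=
        liminf_le_liminf (Eventually.of_forall fun i => (h (ns i)).lintegral_le)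
    _ = _ := liminf_const _

end L2Limits

/-! ### Fourth moment bounds for the two series -/

section Chaos

variable {ρ : ℕ → Measure ℝ} [∀ n, IsProbabilityMeasure (ρ n)]

lemma IsAdmissible.exists_moment_bound (hρ : IsAdmissible ρ) : ∃ K : ℝ, ∀ n,
    (Integrable (fun x : ℝ => x ^ 4) (ρ n) ∧ ∫ x, x ^ 4 ∂(ρ n) ≤ K) ∧
    (Integrable (fun x : ℝ => (x ^ 2 - 1) ^ 4) (ρ n) ∧ ∫ x, (x ^ 2 - 1) ^ 4 ∂(ρ n) ≤ K) := by
  obtain ⟨K₁, h₁⟩ := hρ.moments_bounded 4 (by norm_num)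
  obtain ⟨K₂, h₂⟩ := hρ.moments_bounded 8 (by norm_num)
  refine ⟨max K₁ (8 * (K₂ + 1)), fun n => ⟨⟨(h₁ n).1, (h₁ n).2.trans (le_max_left _ _)⟩, ?_⟩⟩
  have hint : Integrable (fun x : ℝ => 8 * (x ^ 8 + 1)) (ρ n) :=
    ((h₂ n).1.add (integrable_const 1)).const_mul 8
  have hle : ∀ x : ℝ, (x ^ 2 - 1) ^ 4 ≤ 8 * (x ^ 8 + 1) := by
    intro x
    have h1 : (x ^ 2 + 1) ^ 4 ≤ 8 * (x ^ 8 + 1) := by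
      refine (add_pow_le (sq_nonneg x) zero_le_one 4).trans (le_of_eq ?_)
      ring
    have h2 : (x ^ 2 - 1) ^ 4 ≤ (x ^ 2 + 1) ^ 4 := by
      rw [← Even.pow_abs (by decide) (x ^ 2 - 1)]
      refine pow_le_pow_left₀ (abs_nonneg _) ?_ 4
      rw [abs_le]
      constructor <;> nlinarith [sq_nonneg x]
    exact h2.trans h1
  have hi : Integrable (fun x : ℝ => (x ^ 2 - 1) ^ 4) (ρ n) :=
    hint.mono' (by fun_prop) (Eventually.of_forall fun x => by
      rw [Real.norm_eq_abs, abs_of_nonneg (by positivity)]; exact hle x)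
  refine ⟨hi, (integral_mono hi hint hle).trans ?_⟩
  rw [integral_const_mul, integral_add (h₂ n).1 (integrable_const 1)]
  refine le_trans ?_ (le_max_right _ _)
  simpa using (h₂ n).2

lemma IsAdmissible.integral_sq_sub_one (hρ : IsAdmissible ρ) (n : ℕ) :
    ∫ x, (x ^ 2 - 1) ∂(ρ n) = 0 := by
  obtain ⟨_, h⟩ := hρ.moments_bounded 2 (by norm_num)
  rw [integral_sub (h n).1 (integrable_const 1), hρ.second_moment_eq_one]
  simp

/-- There is a constant bounding the fourth moments of the two kinds of random sums by the sums of the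
squares of their coefficients. -/
theorem IsAdmissible.exists_chaos_bound (hρ : IsAdmissible ρ) : ∃ L : ℝ, 0 ≤ L ∧
    (∀ (b : ℕ → ℝ) (m n : ℕ), m ≤ n →
      FourthMomentLE (law ρ) (fun ω => ∑ j ∈ Finset.Ico m n, b j * (X j ω ^ 2 - 1))
        (L * ∑ j ∈ Finset.Ico m n, b j ^ 2)) ∧
    ∀ (c : ℕ → ℕ → ℝ) (m n : ℕ), m ≤ n →
      FourthMomentLE (law ρ)
        (fun ω => ∑ j ∈ Finset.Ico m n, (∑ k ∈ Finset.range j, c j k * X k ω) * X j ω)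
        (L * ∑ j ∈ Finset.Ico m n, ∑ k ∈ Finset.range j, c j k ^ 2) := by
  obtain ⟨K, hK⟩ := hρ.exists_moment_bound
  have hK0 : 0 ≤ K := (integral_nonneg fun ω => by positivity).trans (hK 0).1.2
  set M := 4 * (1 + K) with hM
  have hM1 : 1 ≤ M := by linarith
  -- The diagonal sums cost one factor M and the double sums two; M ≥ 1 allows the common constant
  -- M².
  have hMM : M ≤ M ^ 2 := by nlinarith
  have hconst : ∀ b : ℝ, FourthMomentLE (law ρ) (fun _ => b) (b ^ 2) := by
    intro b
    constructor
    · exact integrable_const _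
    · simp only [integral_const, probReal_univ, one_smul]
      exact le_of_eq (by ring)
  refine ⟨M ^ 2, by positivity, fun b m n hmn => ?_, fun c m n hmn => ?_⟩
  · have h := (fourthMomentLE_sum_mul (ρ := ρ) (A := fun j _ => b j) (a := fun j => b j ^ 2)
      (φ := fun x => x ^ 2 - 1) (fun j => measurable_const) (fun j => sq_nonneg _)
      (fun j => hconst _) (by fun_prop) hρ.integral_sq_sub_one (fun j => (hK j).2.1)
      (fun j => (hK j).2.2) hmn).2
    have h0 : 0 ≤ ∑ j ∈ Finset.Ico m n, b j ^ 2 := Finset.sum_nonneg fun j _ => sq_nonneg _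
    exact h.mono (by positivity) (by gcongr)
  -- The inner sum over k < j is itself a martingale sum with constant coefficients; its bound
  -- serves as the scale of A_j in the outer sum.
  · have hlin := fun j => fourthMomentLE_sum_mul (ρ := ρ) (A := fun k _ => c j k)
      (a := fun k => c j k ^ 2) (φ := fun x => x) (fun k => measurable_const)
      (fun k => sq_nonneg _) (fun k => hconst _) measurable_id hρ.mean_eq_zero
      (fun k => (hK k).1.1) (fun k => (hK k).1.2) (Nat.zero_le j)
    simp only [← Finset.range_eq_Ico] at hlin
    have h := (fourthMomentLE_sum_mul (ρ := ρ) (φ := fun x => x) (fun j => (hlin j).1)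
      (fun j => mul_nonneg (by positivity) (Finset.sum_nonneg fun k _ => sq_nonneg _))
      (fun j => (hlin j).2) measurable_id hρ.mean_eq_zero (fun j => (hK j).1.1)
      (fun j => (hK j).1.2) hmn).2
    rw [← Finset.mul_sum, ← mul_assoc, ← sq] at h
    exact h

end Chaos

end DoubleIntegral

namespace DoubleIntegral
open ProbabilityTheory

/-! ### Kernels, Bessel's inequality and the Lipschitz bound -/

section Kernels

variable {μ : Measure ℝ}

/-- The added term j = 0 has an empty inner sum; this puts the series in the form used by
`exists_isL2Limit`. -/
lemma phi11Partial_eq (e : HilbertBasis ℕ ℝ (Lp ℝ 2 μ)) (f : ℝ × ℝ → ℝ) (N : ℕ) (ω : Omega) :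
    phi11Partial e f N ω =
    ∑ j ∈ Finset.range (N + 1), (∑ k ∈ Finset.range j, coeff e f j k * X k ω) * X j ω := by
  rw [phi11Partial, Finset.range_eq_Ico, Finset.sum_eq_sum_Ico_succ_bot (Nat.succ_pos N)]
  simp only [Finset.range_zero, Finset.sum_empty, zero_mul, zero_add]
  rfl

lemma integral_sq_indicator_Ioc (g : Lp ℝ 2 μ) {s t : ℝ} (hst : s ≤ t) :
    ∫ x, (Set.Ioc s t).indicator g x ^ 2 ∂μ =
      (∫ x in (0 : ℝ)..t, g x ^ 2 ∂μ) - ∫ x in (0 : ℝ)..s, g x ^ 2 ∂μ := by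
  have hi := (Lp.memLp g).integrable_sq
  rw [intervalIntegral.integral_interval_sub_left hi.intervalIntegrable hi.intervalIntegrable,
    intervalIntegral.integral_of_le hst, ← integral_indicator measurableSet_Ioc]
  congr 1 with x
  by_cases hx : x ∈ Set.Ioc s t <;> simp [hx]

lemma memLp_two_mul_prod {h g : ℝ → ℝ} (hh : MemLp h 2 μ) (hg : MemLp g 2 μ) :
    MemLp (fun p : ℝ × ℝ => h p.1 * g p.2) 2 (μ.prod μ) := by
  have hm : AEStronglyMeasurable (fun p : ℝ × ℝ => h p.1 * g p.2) (μ.prod μ) :=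
    hh.1.comp_fst.mul hg.1.comp_snd
  rw [memLp_two_iff_integrable_sq hm]
  refine (hh.integrable_sq.mul_prod hg.integrable_sq).congr (Eventually.of_forall fun p => ?_)
  simp only [mul_pow]

/-- The difference of the two triangles lies in the strip s < y ≤ t; dropping the constraint 0 ≤ x <
y leaves a product kernel whose norm factorizes. -/
lemma sq_kernel_sub_le (h g : Lp ℝ 2 μ) {s t : ℝ} (hst : s ≤ t) (p : ℝ × ℝ) :
    (kernel h g t - kernel h g s) p ^ 2 ≤ (h p.1 * (Set.Ioc s t).indicator g p.2) ^ 2 := by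
  by_cases ht : p ∈ lowerC t
  · by_cases hs : p ∈ lowerC s
    · simp only [kernel, Pi.sub_apply, Set.indicator_of_mem ht, Set.indicator_of_mem hs, sub_self,
        zero_pow two_ne_zero]
      exact sq_nonneg _
    · have hp : p.2 ∈ Set.Ioc s t := ⟨lt_of_not_ge fun h => hs ⟨ht.1, ht.2.1, h⟩, ht.2.2⟩
      simp [kernel, Set.indicator_of_mem ht, Set.indicator_of_notMem hs, Set.indicator_of_mem hp]
  · have hs : p ∉ lowerC s := fun h => ht ⟨h.1, h.2.1, h.2.2.trans hst⟩
    simp only [kernel, Pi.sub_apply, Set.indicator_of_notMem ht, Set.indicator_of_notMem hs,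
      sub_self, zero_pow two_ne_zero]
    exact sq_nonneg _

lemma sq_symKernel_sub_le (h g : Lp ℝ 2 μ) {s t : ℝ} (hst : s ≤ t) (p : ℝ × ℝ) :
    (symKernel h g t - symKernel h g s) p ^ 2 ≤
      2 * (h p.1 * (Set.Ioc s t).indicator g p.2) ^ 2 +
        2 * ((Set.Ioc s t).indicator g p.1 * h p.2) ^ 2 := by
  have hswap : ∀ u, (upperC u).indicator (fun p => g p.1 * h p.2) p = kernel h g u p.swap := by
    intro u
    simp only [kernel, mul_comm]
    rfl
  have h1 := sq_kernel_sub_le h g hst p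
  have h2 := sq_kernel_sub_le h g hst p.swap
  simp only [Pi.sub_apply, Prod.fst_swap, Prod.snd_swap] at h1 h2
  rw [mul_comm (h p.2)] at h2
  simp only [symKernel, Pi.sub_apply, Pi.add_apply, hswap]
  nlinarith [sq_nonneg (kernel h g t p - kernel h g s p -
    (kernel h g t p.swap - kernel h g s p.swap))]

lemma memLp_basis_mul_basis (e : HilbertBasis ℕ ℝ (Lp ℝ 2 μ)) (j k : ℕ) :
    MemLp (fun p : ℝ × ℝ => e j p.1 * e k p.2) 2 (μ.prod μ) :=
  memLp_two_mul_prod (Lp.memLp _) (Lp.memLp _)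

lemma measurableSet_lowerC (t : ℝ) : MeasurableSet (lowerC t) :=
  (measurableSet_le measurable_const measurable_fst).inter
    ((measurableSet_lt measurable_fst measurable_snd).inter
      (measurableSet_le measurable_snd measurable_const))

lemma measurableSet_upperC (t : ℝ) : MeasurableSet (upperC t) :=
  (measurableSet_le measurable_const measurable_snd).inter
    ((measurableSet_lt measurable_snd measurable_fst).inter
      (measurableSet_le measurable_fst measurable_const))

lemma memLp_kernel (h g : Lp ℝ 2 μ) (t : ℝ) : MemLp (kernel h g t) 2 (μ.prod μ) :=
  (memLp_two_mul_prod (Lp.memLp h) (Lp.memLp g)).indicator (measurableSet_lowerC t)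

lemma memLp_symKernel (h g : Lp ℝ 2 μ) (t : ℝ) : MemLp (symKernel h g t) 2 (μ.prod μ) :=
  (memLp_kernel h g t).add
    ((memLp_two_mul_prod (Lp.memLp g) (Lp.memLp h)).indicator (measurableSet_upperC t))

lemma coeff_sub (e : HilbertBasis ℕ ℝ (Lp ℝ 2 μ)) {f g : ℝ × ℝ → ℝ} (hf : MemLp f 2 (μ.prod μ)) (hg : MemLp g 2 (μ.prod μ))
    (j k : ℕ) : coeff e (f - g) j k = coeff e f j k - coeff e g j k := by
  have hint : ∀ {u : ℝ × ℝ → ℝ}, MemLp u 2 (μ.prod μ) →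
      Integrable (fun p => u p * (e j p.1 * e k p.2)) (μ.prod μ) := fun hu =>
    hu.integrable_mul (memLp_basis_mul_basis e j k)
  simp only [coeff, Pi.sub_apply, sub_mul]
  exact integral_sub (hint hf) (hint hg)

variable [SigmaFinite μ]

lemma integral_sq_mul_prod (h g : ℝ → ℝ) :
    ∫ p : ℝ × ℝ, (h p.1 * g p.2) ^ 2 ∂(μ.prod μ) = (∫ x, h x ^ 2 ∂μ) * ∫ x, g x ^ 2 ∂μ := by
  simp only [mul_pow]
  exact integral_prod_mul (fun x => h x ^ 2) fun x => g x ^ 2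

variable (e : HilbertBasis ℕ ℝ (Lp ℝ 2 μ))

lemma orthonormal_basis_mul_basis : Orthonormal ℝ fun q : ℕ × ℕ =>
    (memLp_basis_mul_basis e q.1 q.2).toLp _ := by
  rw [orthonormal_iff_ite]
  intro q r
  have horth := orthonormal_iff_ite.1 e.orthonormal
  have hinner : ∀ i j, ∫ x, e i x * e j x ∂μ = if i = j then 1 else 0 := by
    intro i j
    rw [← horth, L2.inner_def]
    simp [mul_comm]
  rw [L2.inner_def]
  calc ∫ p, inner ℝ ((memLp_basis_mul_basis e q.1 q.2).toLp _ p)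
        ((memLp_basis_mul_basis e r.1 r.2).toLp _ p) ∂(μ.prod μ)
      = ∫ p : ℝ × ℝ, (e q.1 p.1 * e r.1 p.1) * (e q.2 p.2 * e r.2 p.2) ∂(μ.prod μ) := by
        refine integral_congr_ae ?_
        filter_upwards [(memLp_basis_mul_basis e q.1 q.2).coeFn_toLp,
          (memLp_basis_mul_basis e r.1 r.2).coeFn_toLp] with p h1 h2
        rw [h1, h2]
        simp only [RCLike.inner_apply, conj_trivial]
        ring
    _ = (∫ x, e q.1 x * e r.1 x ∂μ) * ∫ x, e q.2 x * e r.2 x ∂μ :=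
        integral_prod_mul (fun x => e q.1 x * e r.1 x) fun x => e q.2 x * e r.2 x
    _ = _ := by
        rw [hinner, hinner]
        simp only [Prod.ext_iff]
        split_ifs <;> simp_all

/-- Bessel's inequality for the orthonormal system `e j ⊗ e k`. -/
lemma sum_coeff_sq_le {f : ℝ × ℝ → ℝ} (hf : MemLp f 2 (μ.prod μ)) (n : ℕ) :
    ∑ j ∈ Finset.range n, ∑ k ∈ Finset.range n, coeff e f j k ^ 2
      ≤ ∫ p, f p ^ 2 ∂(μ.prod μ) := by
  have h := (orthonormal_basis_mul_basis e).sum_inner_products_le (hf.toLp f)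
    (s := Finset.range n ×ˢ Finset.range n)
  have hnorm : ‖hf.toLp f‖ ^ 2 = ∫ p, f p ^ 2 ∂(μ.prod μ) := by
    rw [← real_inner_self_eq_norm_sq, L2.inner_def]
    refine integral_congr_ae ?_
    filter_upwards [hf.coeFn_toLp] with p hp
    rw [hp]
    simp [sq]
  rw [hnorm, Finset.sum_product] at h
  refine le_trans (le_of_eq ?_) h
  refine Finset.sum_congr rfl fun j _ => Finset.sum_congr rfl fun k _ => ?_
  rw [Real.norm_eq_abs, sq_abs, L2.inner_def, coeff]
  congr 1
  refine integral_congr_ae ?_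
  filter_upwards [hf.coeFn_toLp, (memLp_basis_mul_basis e j k).coeFn_toLp] with p h1 h2
  rw [h1, h2]
  simp

lemma sum_diag_coeff_sq_le {f : ℝ × ℝ → ℝ} (hf : MemLp f 2 (μ.prod μ)) (n : ℕ) :
    ∑ j ∈ Finset.range n, coeff e f j j ^ 2 ≤ ∫ p, f p ^ 2 ∂(μ.prod μ) := by
  refine le_trans (Finset.sum_le_sum fun j hj => ?_) (sum_coeff_sq_le e hf n)
  exact Finset.single_le_sum (f := fun k => coeff e f j k ^ 2) (fun _ _ => sq_nonneg _) hj

lemma sum_offDiag_coeff_sq_le {f : ℝ × ℝ → ℝ} (hf : MemLp f 2 (μ.prod μ)) (n : ℕ) :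
    ∑ j ∈ Finset.range n, ∑ k ∈ Finset.range j, coeff e f j k ^ 2
      ≤ ∫ p, f p ^ 2 ∂(μ.prod μ) := by
  refine le_trans (Finset.sum_le_sum fun j hj => ?_) (sum_coeff_sq_le e hf n)
  exact Finset.sum_le_sum_of_subset_of_nonneg
    (Finset.range_subset_range.2 (Finset.mem_range.1 hj).le) fun _ _ _ => sq_nonneg _

variable {ρ : ℕ → Measure ℝ} [∀ n, IsProbabilityMeasure (ρ n)]

theorem isL2Limit_phi2 (hρ : IsAdmissible ρ) {f : ℝ × ℝ → ℝ} (hf : MemLp f 2 (μ.prod μ)) :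
    IsL2Limit (law ρ) (phi2Partial e f) (phi2 e (law ρ) f) := by
  obtain ⟨L, hL0, hL, -⟩ := hρ.exists_chaos_bound
  refine isL2Limit_l2Limit (exists_isL2Limit (a := fun j => L * coeff e f j j ^ 2)
    (fun j => ?_) (fun j => by positivity) ?_ fun m n hmn => ?_)
  · exact (((measurable_X j).pow_const 2).sub_const 1).const_mul _
  · exact (summable_of_sum_range_le (fun j => sq_nonneg _)
      (sum_diag_coeff_sq_le e hf)).mul_left L
  · rw [← Finset.mul_sum]
    exact hL _ m n hmn

theorem isL2Limit_phi11 (hρ : IsAdmissible ρ) {f : ℝ × ℝ → ℝ} (hf : MemLp f 2 (μ.prod μ)) :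
    IsL2Limit (law ρ) (phi11Partial e f) (phi11 e (law ρ) f) := by
  obtain ⟨L, hL0, -, hL⟩ := hρ.exists_chaos_bound
  refine isL2Limit_l2Limit ?_
  rw [show phi11Partial e f = _ from funext fun N => funext fun ω => phi11Partial_eq e f N ω]
  refine exists_isL2Limit (a := fun j => L * ∑ k ∈ Finset.range j, coeff e f j k ^ 2)
    (fun j => ?_) (fun j => mul_nonneg hL0 (Finset.sum_nonneg fun k _ => sq_nonneg _)) ?_
    fun m n hmn => ?_
  · exact (Finset.measurable_fun_sum _ fun k _ => (measurable_X k).const_mul _).mul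
      (measurable_X j)
  · exact (summable_of_sum_range_le (fun j => Finset.sum_nonneg fun k _ => sq_nonneg _)
      (sum_offDiag_coeff_sq_le e hf)).mul_left L
  · rw [← Finset.mul_sum]
    exact hL _ m n hmn

/-- Both integrals are Lipschitz from `L²(μ ⊗ μ)` to `L⁴(P)`. -/
theorem IsAdmissible.exists_lintegral_phi_sub_le (hρ : IsAdmissible ρ) : ∃ L : ℝ, 0 ≤ L ∧
    ∀ f g : ℝ × ℝ → ℝ, MemLp f 2 (μ.prod μ) → MemLp g 2 (μ.prod μ) → ∀ M : ℝ,
      ∫ p, (f - g) p ^ 2 ∂(μ.prod μ) ≤ M →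
      ∫⁻ ω, ‖phi2 e (law ρ) f ω - phi2 e (law ρ) g ω‖ₑ ^ 4 ∂(law ρ)
          ≤ ENNReal.ofReal ((L * M) ^ 2) ∧
        ∫⁻ ω, ‖phi11 e (law ρ) f ω - phi11 e (law ρ) g ω‖ₑ ^ 4 ∂(law ρ)
          ≤ ENNReal.ofReal ((L * M) ^ 2) := by
  obtain ⟨L, hL0, hL2, hL11⟩ := hρ.exists_chaos_bound
  refine ⟨L, hL0, fun f g hf hg M hM => ⟨?_, ?_⟩⟩
  · refine (isL2Limit_phi2 e hρ hf).lintegral_sub_le (isL2Limit_phi2 e hρ hg) fun N => ?_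
    have h := hL2 (fun j => coeff e (f - g) j j) 0 (N + 1) (Nat.zero_le _)
    rw [← Finset.range_eq_Ico] at h
    have heq : phi2Partial e f N - phi2Partial e g N = fun ω =>
        ∑ j ∈ Finset.range (N + 1), coeff e (f - g) j j * (X j ω ^ 2 - 1) := by
      ext ω
      simp only [Pi.sub_apply, phi2Partial, coeff_sub e hf hg, sub_mul, Finset.sum_sub_distrib]
    rw [heq]
    exact h.mono (mul_nonneg hL0 (Finset.sum_nonneg fun j _ => sq_nonneg _))
      (mul_le_mul_of_nonneg_left ((sum_diag_coeff_sq_le e (hf.sub hg) _).trans hM) hL0)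
  · refine (isL2Limit_phi11 e hρ hf).lintegral_sub_le (isL2Limit_phi11 e hρ hg) fun N => ?_
    have h := hL11 (coeff e (f - g)) 0 (N + 1) (Nat.zero_le _)
    rw [← Finset.range_eq_Ico] at h
    have heq : phi11Partial e f N - phi11Partial e g N = fun ω => ∑ j ∈ Finset.range (N + 1),
        (∑ k ∈ Finset.range j, coeff e (f - g) j k * X k ω) * X j ω := by
      ext ω
      simp only [Pi.sub_apply, phi11Partial_eq, coeff_sub e hf hg, sub_mul,
        Finset.sum_sub_distrib]
    rw [heq]
    exact h.mono (mul_nonneg hL0 (Finset.sum_nonneg fun j _ => Finset.sum_nonneg fun k _ =>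
      sq_nonneg _))
      (mul_le_mul_of_nonneg_left ((sum_offDiag_coeff_sq_le e (hf.sub hg) _).trans hM) hL0)

lemma integral_sq_kernel_sub_le (h g : Lp ℝ 2 μ) {s t : ℝ} (hst : s ≤ t) :
    ∫ p, (kernel h g t - kernel h g s) p ^ 2 ∂(μ.prod μ) ≤ (∫ x, h x ^ 2 ∂μ) *
      ((∫ x in (0 : ℝ)..t, g x ^ 2 ∂μ) - ∫ x in (0 : ℝ)..s, g x ^ 2 ∂μ) := by
  rw [← integral_sq_indicator_Ioc g hst, ← integral_sq_mul_prod]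
  have hg := (Lp.memLp g).indicator (measurableSet_Ioc (a := s) (b := t))
  exact integral_mono ((memLp_kernel h g t).sub (memLp_kernel h g s)).integrable_sq
    (memLp_two_mul_prod (Lp.memLp h) hg).integrable_sq (sq_kernel_sub_le h g hst)

lemma integral_sq_symKernel_sub_le (h g : Lp ℝ 2 μ) {s t : ℝ} (hst : s ≤ t) :
    ∫ p, (symKernel h g t - symKernel h g s) p ^ 2 ∂(μ.prod μ) ≤ 4 * ((∫ x, h x ^ 2 ∂μ) *
      ((∫ x in (0 : ℝ)..t, g x ^ 2 ∂μ) - ∫ x in (0 : ℝ)..s, g x ^ 2 ∂μ)) := by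
  have hg := (Lp.memLp g).indicator (measurableSet_Ioc (a := s) (b := t))
  have i1 := (memLp_two_mul_prod (Lp.memLp h) hg).integrable_sq.const_mul 2
  have i2 := (memLp_two_mul_prod hg (Lp.memLp h)).integrable_sq.const_mul 2
  refine (integral_mono ((memLp_symKernel h g t).sub (memLp_symKernel h g s)).integrable_sq
    (i1.add i2) (sq_symKernel_sub_le h g hst)).trans (le_of_eq ?_)
  rw [integral_add' i1 i2, integral_const_mul, integral_const_mul, integral_sq_mul_prod,
    integral_sq_mul_prod, integral_sq_indicator_Ioc g hst]
  ring

end Kernels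

end DoubleIntegral

namespace DoubleIntegral
open ProbabilityTheory

/-! ### Increments of the double integral and the time change -/

section Modification

lemma enorm_add_pow_four_le (a b : ℝ) : ‖a + b‖ₑ ^ 4 ≤ 8 * (‖a‖ₑ ^ 4 + ‖b‖ₑ ^ 4) := by
  have h : ‖a + b‖ ^ 4 ≤ 8 * (‖a‖ ^ 4 + ‖b‖ ^ 4) :=
    (pow_le_pow_left₀ (norm_nonneg _) (norm_add_le a b) 4).trans
      ((add_pow_le (norm_nonneg a) (norm_nonneg b) 4).trans (le_of_eq (by norm_num)))
  have h' : ‖a + b‖₊ ^ 4 ≤ 8 * (‖a‖₊ ^ 4 + ‖b‖₊ ^ 4) := by exact_mod_cast h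
  simp only [enorm_eq_nnnorm]
  exact_mod_cast h'

variable {μ : Measure ℝ} [SigmaFinite μ] (e : HilbertBasis ℕ ℝ (Lp ℝ 2 μ))
  {ρ : ℕ → Measure ℝ} [∀ n, IsProbabilityMeasure (ρ n)]

lemma aestronglyMeasurable_Z (hρ : IsAdmissible ρ) (h g : Lp ℝ 2 μ) (t : ℝ≥0) :
    AEStronglyMeasurable (Z e (law ρ) h g t) (law ρ) :=
  (isL2Limit_phi11 e hρ (memLp_symKernel h g t)).2.1.1.add
    (isL2Limit_phi2 e hρ (memLp_kernel h g t)).2.1.1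

/-- The fourth moments of the increments of the double integral. -/
theorem exists_lintegral_Z_sub_le (hρ : IsAdmissible ρ) (h g : Lp ℝ 2 μ) : ∃ C : ℝ, 0 ≤ C ∧
    ∀ s t : ℝ≥0, ∫⁻ ω, ‖Z e (law ρ) h g t ω - Z e (law ρ) h g s ω‖ₑ ^ 4 ∂(law ρ) ≤
      ENNReal.ofReal (C * ((∫ x in (0 : ℝ)..t, g x ^ 2 ∂μ) - ∫ x in (0 : ℝ)..s, g x ^ 2 ∂μ) ^ 2) := by
  obtain ⟨L, hL0, hL⟩ := IsAdmissible.exists_lintegral_phi_sub_le (e := e) hρ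
  set A := ∫ x, h x ^ 2 ∂μ with hA
  -- Here 8 comes from (a + b)⁴ ≤ 8(a⁴ + b⁴) and 17 = 4² + 1 from the symmetrized kernel, with its
  -- factor 4, and the plain one.
  have key : ∀ s t : ℝ≥0, s ≤ t →
      ∫⁻ ω, ‖Z e (law ρ) h g t ω - Z e (law ρ) h g s ω‖ₑ ^ 4 ∂(law ρ) ≤
      ENNReal.ofReal (8 * (17 * (L * A) ^ 2) *
        ((∫ x in (0 : ℝ)..t, g x ^ 2 ∂μ) - ∫ x in (0 : ℝ)..s, g x ^ 2 ∂μ) ^ 2) := by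
    intro s t hst
    have hst' : (s : ℝ) ≤ t := by exact_mod_cast hst
    have h2 := (hL _ _ (memLp_kernel h g t) (memLp_kernel h g s) _
      (integral_sq_kernel_sub_le h g hst')).1
    have h11 := (hL _ _ (memLp_symKernel h g t) (memLp_symKernel h g s) _
      (integral_sq_symKernel_sub_le h g hst')).2
    have hm : AEMeasurable (fun ω => ‖phi2 e (law ρ) (kernel h g t) ω -
        phi2 e (law ρ) (kernel h g s) ω‖ₑ ^ 4) (law ρ) :=
      ((isL2Limit_phi2 e hρ (memLp_kernel h g t)).2.1.1.sub
        (isL2Limit_phi2 e hρ (memLp_kernel h g s)).2.1.1).enorm.pow_const 4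
    refine (lintegral_mono fun ω => ?_).trans ((lintegral_const_mul' 8 _ (by norm_num)).trans_le
      ((mul_le_mul_right (((lintegral_add_right' _ hm).trans_le (add_le_add h11 h2))) 8).trans
        (le_of_eq ?_)))
    · rw [Z, Z, Pi.add_apply, Pi.add_apply, add_sub_add_comm]
      exact enorm_add_pow_four_le _ _
    · rw [← ENNReal.ofReal_add (sq_nonneg _) (sq_nonneg _),
        show (8 : ℝ≥0∞) = ENNReal.ofReal 8 by simp, ← ENNReal.ofReal_mul (by norm_num)]
      congr 1
      ring
  refine ⟨8 * (17 * (L * A) ^ 2), by positivity, fun s t => ?_⟩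
  rcases le_total s t with hst | hst
  · exact key s t hst
  · have := key t s hst
    simp_rw [enorm_sub_rev (Z e (law ρ) h g s _)] at this
    refine this.trans (le_of_eq ?_)
    congr 1
    ring

theorem exists_isContinuousModification_Z [NullSingletonClass μ] (hρ : IsAdmissible ρ)
    (h g : Lp ℝ 2 μ) :
    ∃ Y : ℝ≥0 → Omega → ℝ, IsContinuousModification (law ρ) (Z e (law ρ) h g) Y := by
  obtain ⟨C, hC0, hC⟩ := exists_lintegral_Z_sub_le e hρ h g
  have hg := (Lp.memLp g).integrable_sq
  set F : ℝ → ℝ := fun t => ∫ x in (0 : ℝ)..t, g x ^ 2 ∂μ with hF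
  -- Diffuseness of μ enters here: an atom could make F jump.
  have hFc : Continuous F :=
    intervalIntegral.continuous_primitive (fun a b => hg.intervalIntegrable) 0
  have hFmono : ∀ s t : ℝ, s ≤ t → F s ≤ F t := by
    intro s t hst
    rw [← sub_nonneg, hF]
    simp only
    rw [← integral_sq_indicator_Ioc g hst]
    exact integral_nonneg fun x => sq_nonneg _
  have hF0 : F 0 = 0 := intervalIntegral.integral_same
  have hFnn : ∀ t : ℝ≥0, 0 ≤ F t := fun t => hF0 ▸ hFmono 0 t t.2
  -- F is bounded and may be constant on intervals; the added t makes G onto [0, ∞), as G(0) = 0 and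
  -- G(c) ≥ c.
  set G : ℝ≥0 → ℝ≥0 := fun t => t + (F t).toNNReal with hG
  have hGc : Continuous G := by fun_prop
  have hGreal : ∀ t : ℝ≥0, (G t : ℝ) = t + F t := by
    intro t
    rw [hG, NNReal.coe_add, Real.coe_toNNReal _ (hFnn t)]
  have hFG : ∀ s t : ℝ≥0, (F t - F s) ^ 2 ≤ ((G t : ℝ) - G s) ^ 2 := by
    intro s t
    rw [hGreal, hGreal, sq_le_sq]
    rcases le_total s t with hst | hst
    · have h1 : (s : ℝ) ≤ t := by exact_mod_cast hst
      have h2 := hFmono s t h1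
      rw [abs_of_nonneg (by linarith), abs_of_nonneg (by linarith)]
      linarith
    · have h1 : (t : ℝ) ≤ s := by exact_mod_cast hst
      have h2 := hFmono t s h1
      rw [abs_of_nonpos (by linarith), abs_of_nonpos (by linarith)]
      linarith
  have hsurj : Function.Surjective G := by
    intro c
    refine mem_range_of_exists_le_of_exists_ge hGc ⟨0, ?_⟩ ⟨c, le_self_add⟩
    simp [hG, hF0]
  obtain ⟨r, hr⟩ := hsurj.hasRightInverse
  have hZm := fun t => aestronglyMeasurable_Z e hρ h g t
  -- Z is an arbitrary choice of L² limits, hence only almost everywhere measurable; measurable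
  -- versions of Z at time r(u) are used.
  obtain ⟨Y, hYm, hYc, hY⟩ := exists_continuous_modification (P := law ρ)
    (W := fun u => (hZm (r u)).mk) (fun u => (hZm (r u)).stronglyMeasurable_mk.measurable) hC0 (by
      intro u v
      refine (lintegral_congr_ae ?_).trans_le ((hC (r v) (r u)).trans
        (ENNReal.ofReal_le_ofReal (mul_le_mul_of_nonneg_left ?_ hC0)))
      · filter_upwards [(hZm (r u)).ae_eq_mk, (hZm (r v)).ae_eq_mk] with ω h1 h2
        rw [h1, h2]
      · simpa only [hr u, hr v] using hFG (r v) (r u))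
  refine ⟨fun t => Y (G t), fun t => hYm _, fun ω => (hYc ω).comp hGc, fun t => ?_⟩
  -- Injectivity of G is not needed: r(G t) and t have the same G, hence the same F, so Z agrees
  -- almost surely at the two times.
  have hzero : ∫⁻ ω, ‖Z e (law ρ) h g (r (G t)) ω - Z e (law ρ) h g t ω‖ₑ ^ 4 ∂(law ρ) = 0 := by
    refine le_antisymm ((hC t (r (G t))).trans ?_) zero_le
    have h0 := hFG t (r (G t))
    rw [hr (G t), sub_self, zero_pow two_ne_zero] at h0
    rw [le_antisymm h0 (sq_nonneg _)]
    simp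
  have hzero' := (lintegral_eq_zero_iff'
    (((hZm (r (G t))).sub (hZm t)).enorm.pow_const 4)).1 hzero
  filter_upwards [hY (G t), (hZm (r (G t))).ae_eq_mk, hzero'] with ω h1 h2 h3
  have h4 : Z e (law ρ) h g (r (G t)) ω = Z e (law ρ) h g t ω := by
    simpa [sub_eq_zero] using h3
  rw [h1, ← h2, h4]

end Modification

end DoubleIntegral

theorem mainTheorem2 (μ : Measure ℝ) [SigmaFinite μ] [NullSingletonClass μ]
    (e : HilbertBasis ℕ ℝ (Lp ℝ 2 μ))
    (ρ : ℕ → Measure ℝ) [∀ n, IsProbabilityMeasure (ρ n)]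
    (hρ : DoubleIntegral.IsAdmissible ρ) (h₁ h₂ : Lp ℝ 2 μ) :
    (∀ t : ℝ≥0,
      DoubleIntegral.IsL2Limit (DoubleIntegral.law ρ)
        (DoubleIntegral.phi11Partial e (DoubleIntegral.symKernel h₁ h₂ t))
        (DoubleIntegral.phi11 e (DoubleIntegral.law ρ) (DoubleIntegral.symKernel h₁ h₂ t)) ∧
      DoubleIntegral.IsL2Limit (DoubleIntegral.law ρ)
        (DoubleIntegral.phi2Partial e (DoubleIntegral.kernel h₁ h₂ t))
        (DoubleIntegral.phi2 e (DoubleIntegral.law ρ) (DoubleIntegral.kernel h₁ h₂ t))) ∧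
    ∃ Y : ℝ≥0 → DoubleIntegral.Omega → ℝ,
      DoubleIntegral.IsContinuousModification (DoubleIntegral.law ρ)
        (DoubleIntegral.Z e (DoubleIntegral.law ρ) h₁ h₂) Y :=
  ⟨fun t => ⟨DoubleIntegral.isL2Limit_phi11 e hρ (DoubleIntegral.memLp_symKernel h₁ h₂ t),
    DoubleIntegral.isL2Limit_phi2 e hρ (DoubleIntegral.memLp_kernel h₁ h₂ t)⟩,
    DoubleIntegral.exists_isContinuousModification_Z e hρ h₁ h₂⟩
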